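/- Let $k,s,n\ge 0$ be integers, let $A$ be an $s\times n$ integer matrix of rank $m$, and let $\vec p\in\mathbb Z^n$. Let $U\in\mathrm{GL}_s(\mathbb Z)$ and $V\in\mathrm{GL}_n(\mathbb Z)$ be such that $D=UAV$ is in Smith normal form (its off-diagonal entries are $0$, its diagonal entries are nonnegative, and each of them divides the next), and write $V^{-1}\vec p=(p_1',\dots,p_n')$. Let $$\mathcal H=\{\vec x\in\mathbb R^n : A\vec x=A\vec p\},$$ the intersection of the $s$ hyperplanes given by the rows of $A$. Call $\vec x\in\mathbb Z^n$ $k$-free if $q^k\nmid\gcd(x_1,\dots,x_n)$ for every prime $q$, where the gcd of an empty family or of zeros is $0$. Then the asymptotic density of $k$-free lattice points on $\mathcal H$ exists and $$\lim_{r\to\infty}\frac{\#\{\vec x\in\mathcal H\cap[-r,r]^n\cap\mathbb Z^n:\ \vec x\text{ is }k\text{-free}\}}{\#\left(\mathcal H\cap[-r,r]^n\cap\mathbb Z^n\right)}=\prod_{q^k\mid\gcd(p_1',\dots,p_m')}\left(1-\frac1{q^{k(n-m)}}\right),$$ where $r$ runs over the real numbers and the product is over all primes $q$ with $q^k\mid\gcd(p_1',\dots,p_m')$.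 If $\gcd(p_1',\dots,p_m')=0$, or if $k=0$, this is the product over all primes; an infinite product is understood as the limit of its finite partial products (which exists independently of the order of the factors, and may be $0$). -/

import Mathlib

open Filter Topology Matrix

namespace KFreeDensity

/-- An integer `b` is `k`-free if `p ^ k ∤ b` for every prime `p`. In particular `0` is never
`k`-free. -/
def IsKFree (k : ℕ) (b : ℤ) : Prop :=
  ¬ ∃ p : ℕ, p.Prime ∧ (p : ℤ) ^ k ∣ b

/-- A lattice point is `k`-free if the gcd of all its coordinates is `k`-free. -/
def IsKFreePoint {n : ℕ} (k : ℕ) (x : Fin n → ℤ) : Prop :=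
  IsKFree k (Finset.univ.gcd x)

/-- The lattice points of `Δ ⊆ ℝⁿ` lying in the box `[-r, r]ⁿ`. -/
def latticePoints {n : ℕ} (Δ : Set (Fin n → ℝ)) (r : ℝ) : Set (Fin n → ℤ) :=
  {x | (fun j => (x j : ℝ)) ∈ Δ ∧ ∀ j, (x j : ℝ) ∈ Set.Icc (-r) r}

/-- The `k`-free lattice points of `Δ ⊆ ℝⁿ` lying in the box `[-r, r]ⁿ`. -/
def kFreePoints {n : ℕ} (k : ℕ) (Δ : Set (Fin n → ℝ)) (r : ℝ) : Set (Fin n → ℤ) :=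
  {x | x ∈ latticePoints Δ r ∧ IsKFreePoint k x}

/-- The asymptotic density of `k`-free lattice points in `Δ ⊆ ℝⁿ` exists and equals `ρ`: the
proportion of `k`-free points among the lattice points of `Δ ∩ [-r, r]ⁿ` tends to `ρ` as
`r → ∞`. The sets counted are finite, so `Set.ncard` is their actual size. -/
def HasKFreeDensity {n : ℕ} (k : ℕ) (Δ : Set (Fin n → ℝ)) (ρ : ℝ) : Prop :=
  Tendsto (fun r : ℝ => ((kFreePoints k Δ r).ncard : ℝ) / ((latticePoints Δ r).ncard : ℝ))
    atTop (𝓝 ρ)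

/-- The hyperplane `∑ⱼ aⱼ xⱼ = ∑ⱼ aⱼ pⱼ` in `ℝⁿ` with integral normal vector `a` through the
integral point `p`. -/
def hyperplane {n : ℕ} (a p : Fin n → ℤ) : Set (Fin n → ℝ) :=
  {x | ∑ j, (a j : ℝ) * x j = ∑ j, (a j : ℝ) * (p j : ℝ)}

/-- An `s × n` integer matrix is in Smith normal form if its off-diagonal entries vanish, its
diagonal entries are nonnegative, and each diagonal entry divides the next one. -/
structure IsSmithNormalForm {s n : ℕ} (D : Matrix (Fin s) (Fin n) ℤ) : Prop where
  off_diag : ∀ (i : Fin s) (j : Fin n), (i : ℕ) ≠ (j : ℕ) → D i j = 0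
  nonneg : ∀ (i : Fin s) (j : Fin n), (i : ℕ) = (j : ℕ) → 0 ≤ D i j
  dvd_succ : ∀ (i i' : Fin s) (j j' : Fin n), (i : ℕ) = (j : ℕ) → (i' : ℕ) = (j' : ℕ) →
    (i' : ℕ) = (i : ℕ) + 1 → D i j ∣ D i' j'

/-- The gcd of the first `m` coordinates of an integer vector (`0` if there are none). -/
def gcdFirst {n : ℕ} (m : ℕ) (x : Fin n → ℤ) : ℤ :=
  (Finset.univ.filter fun j : Fin n => (j : ℕ) < m).gcd x

end KFreeDensity

/-! In the coordinates `V⁻¹ x`, the system `A x = A p` says that the first `m` entries agree with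
those of `p'`. The lattice points of the intersection are therefore parametrized injectively by the
remaining `d = n - m` entries `z ∈ ℤ^d` (`range_latticeParam`). The box becomes a condition `‖Λ z +
v‖ ≤ r`, with `Λ` an injective linear map and `v` the image of the first `m` entries of `p'`.
Unimodular matrices preserve divisibility of a whole vector, so `q ^ k` divides `x` iff it divides
`gcd(p'₁, …, p'ₘ)` and every entry of `z` (`dvd_latticeParam_iff`). Only the primes of the product
can spoil `k`-freeness.

The number of `z` with `‖Λ z + v‖ ≤ r` and `M ∣ z` is asymptotic to `vol · (r / M) ^ d`. A finite
sieve then produces the finite products (`tendsto_ncard_sieve`), and every finite subset of the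
primes bounds the density from above.

Infinitely many primes occur only if `k = 0`, where the product vanishes, or if the gcd is `0`,
where `v = 0`. Only a positive product needs a lower bound. Positivity makes `∑ q ^ (-k d)`
converge; since `v = 0`, the nonzero points divisible by `q ^ k` number at most `C r ^ d q ^ (-k d)`
uniformly in `q`, so the large primes are negligible (`exists_finset_ncard_siftedPoints_le`). -/

namespace KFreeDensity

/-! ### Counting lattice points in affine preimages of balls, and the finite sieve. -/

section Counting

variable {ι : Type*} {E : Type*} [NormedAddCommGroup E] [NormedSpace ℝ E]

/-- The integer vectors that the affine map `x ↦ Λ x + v` sends into the closed ball of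
radius `r` around the origin. -/
def affineBallPoints (Λ : (ι → ℝ) →ₗ[ℝ] E) (v : E) (r : ℝ) : Set (ι → ℤ) :=
  {z | ‖Λ (fun i => (z i : ℝ)) + v‖ ≤ r}

/-- The points of `affineBallPoints` all of whose coordinates are multiples of `M` are the
multiples of the points for a rescaled affine map. -/
theorem sep_dvd_affineBallPoints (Λ : (ι → ℝ) →ₗ[ℝ] E) (v : E) (r : ℝ) {M : ℕ} (hM : 0 < M) :
    {z ∈ affineBallPoints Λ v r | ∀ i, (M : ℤ) ∣ z i} =
      (fun (w : ι → ℤ) i => (M : ℤ) * w i) '' affineBallPoints Λ ((M : ℝ)⁻¹ • v) (r / M) := by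
  have hM' : (0 : ℝ) < M := mod_cast hM
  have key : ∀ w : ι → ℤ, (fun i => (M : ℤ) * w i) ∈ affineBallPoints Λ v r ↔
      w ∈ affineBallPoints Λ ((M : ℝ)⁻¹ • v) (r / M) := by
    intro w
    have : Λ (fun i => (((M : ℤ) * w i : ℤ) : ℝ)) + v =
        (M : ℝ) • (Λ (fun i => (w i : ℝ)) + (M : ℝ)⁻¹ • v) := by
      rw [smul_add, smul_inv_smul₀ hM'.ne', ← map_smul]
      congr 2
      funext i
      simp
    simp only [affineBallPoints, Set.mem_ofPred_eq]
    rw [this, norm_smul, le_div_iff₀ hM', mul_comm]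
    simp
  ext z
  constructor
  · rintro ⟨hz, hd⟩
    choose w hw using hd
    obtain rfl : z = fun i => (M : ℤ) * w i := funext hw
    exact ⟨w, (key w).mp hz, rfl⟩
  · rintro ⟨w, hw, rfl⟩
    exact ⟨(key w).mpr hw, fun i => dvd_mul_right _ _⟩

theorem mul_left_pi_injective {M : ℕ} (hM : 0 < M) :
    Function.Injective fun (w : ι → ℤ) i => (M : ℤ) * w i := fun w w' h => by
  funext i
  simpa [hM.ne'] using congrFun h i

variable [Fintype ι]

/-- The volume of the preimage of the closed unit ball under `Λ`. -/
noncomputable def ballVolume (Λ : (ι → ℝ) →ₗ[ℝ] E) : ℝ :=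
  MeasureTheory.volume.real {x | ‖Λ x‖ ≤ 1}

theorem exists_pos_norm_le_mul (Λ : (ι → ℝ) →ₗ[ℝ] E) (hΛ : Function.Injective Λ) :
    ∃ c : ℝ, 0 < c ∧ ∀ x, ‖x‖ ≤ c * ‖Λ x‖ := by
  obtain ⟨K, hK, h⟩ := Λ.exists_antilipschitzWith (LinearMap.ker_eq_bot.mpr hΛ)
  exact ⟨K, mod_cast hK, fun x => h.le_mul_norm (map_zero Λ) x⟩

theorem finite_norm_intCast_le (R : ℝ) :
    {z : ι → ℤ | ‖(fun i => (z i : ℝ))‖ ≤ R}.Finite := by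
  classical
  refine (Set.finite_Icc (fun _ : ι => -⌈R⌉) (fun _ => ⌈R⌉)).subset fun z hz => ?_
  have h : ∀ i, |(z i : ℝ)| ≤ ⌈R⌉ := fun i =>
    ((norm_le_pi_norm (fun i => (z i : ℝ)) i).trans hz).trans (Int.le_ceil R)
  constructor <;> intro i <;> have := abs_le.mp (h i)
  · exact_mod_cast this.1
  · exact_mod_cast this.2

theorem ncard_norm_intCast_le {R : ℝ} (hR : 1 ≤ R) :
    ({z : ι → ℤ | ‖(fun i => (z i : ℝ))‖ ≤ R}.ncard : ℝ) ≤ (3 * R) ^ Fintype.card ι := by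
  classical
  have hsub : {z : ι → ℤ | ‖(fun i => (z i : ℝ))‖ ≤ R} ⊆
      (Fintype.piFinset fun _ : ι => Finset.Icc (-⌊R⌋) ⌊R⌋ : Finset (ι → ℤ)) := by
    intro z hz
    simp only [Finset.mem_coe, Fintype.mem_piFinset, Finset.mem_Icc]
    intro i
    have h := abs_le.mp ((norm_le_pi_norm (fun i => (z i : ℝ)) i).trans hz)
    refine ⟨?_, Int.le_floor.mpr h.2⟩
    have := Int.le_floor.mpr (show ((-z i : ℤ) : ℝ) ≤ R by push_cast; linarith [h.1])
    lia
  have h1 := Set.ncard_le_ncard hsub (Finset.finite_toSet _)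
  rw [Set.ncard_coe_finset, Fintype.card_piFinset, Finset.prod_const, Int.card_Icc,
    Finset.card_univ] at h1
  refine (Nat.cast_le.mpr h1).trans ?_
  push_cast
  gcongr
  have h0 : 0 ≤ ⌊R⌋ := Int.floor_nonneg.mpr (by linarith)
  have : (((⌊R⌋ + 1 - -⌊R⌋).toNat : ℤ) : ℝ) = ⌊R⌋ + 1 + ⌊R⌋ := by
    rw [Int.toNat_of_nonneg (by lia)]; push_cast; ring
  rw [Int.cast_natCast] at this
  rw [this]
  linarith [Int.floor_le R]

variable {Λ : (ι → ℝ) →ₗ[ℝ] E}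

theorem finite_affineBallPoints (hΛ : Function.Injective Λ) (v : E) (r : ℝ) :
    (affineBallPoints Λ v r).Finite := by
  obtain ⟨c, hc, h⟩ := exists_pos_norm_le_mul Λ hΛ
  refine (finite_norm_intCast_le (c * (r + ‖v‖))).subset fun z hz => ?_
  refine (h _).trans (mul_le_mul_of_nonneg_left ?_ hc.le)
  have hz' : ‖Λ (fun i => (z i : ℝ)) + v‖ ≤ r := hz
  have := norm_le_norm_add_norm_sub' (Λ (fun i => (z i : ℝ))) (Λ (fun i => (z i : ℝ)) + v)
  simp only [sub_add_cancel_left, norm_neg] at this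
  linarith

theorem isBounded_preimage_ball (hΛ : Function.Injective Λ) :
    Bornology.IsBounded {x | ‖Λ x‖ ≤ 1} := by
  obtain ⟨c, hc, h⟩ := exists_pos_norm_le_mul Λ hΛ
  refine isBounded_iff_forall_norm_le.mpr ⟨c, fun x hx => (h x).trans ?_⟩
  exact mul_le_of_le_one_right hc.le hx

theorem ballVolume_pos (hΛ : Function.Injective Λ) : 0 < ballVolume Λ := by
  have hcont : Continuous Λ := LinearMap.continuous_of_finiteDimensional Λ
  refine ENNReal.toReal_pos (ne_of_gt ?_) (isBounded_preimage_ball hΛ).measure_lt_top.ne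
  have ho : IsOpen {x | ‖Λ x‖ < 1} := isOpen_lt hcont.norm continuous_const
  refine (ho.measure_pos MeasureTheory.volume ⟨0, by simp⟩).trans_le
    (MeasureTheory.measure_mono fun x hx => ?_)
  exact (show ‖Λ x‖ < 1 from hx).le

-- The preimage of the unit ball is bounded and convex, so its frontier is null and counting points
-- of `r⁻¹ • ℤ^d` in it yields its volume. Nestedness of its dilates lets `r` run over the reals.
open scoped Pointwise in
theorem tendsto_ncard_linear (hΛ : Function.Injective Λ) :
    Tendsto (fun r : ℝ => ((affineBallPoints Λ 0 r).ncard : ℝ) / r ^ Fintype.card ι) atTop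
      (𝓝 (ballVolume Λ)) := by
  have hcont : Continuous Λ := LinearMap.continuous_of_finiteDimensional Λ
  have hclosed : IsClosed {x | ‖Λ x‖ ≤ 1} := isClosed_le hcont.norm continuous_const
  have hconv : Convex ℝ {x | ‖Λ x‖ ≤ 1} := by
    have := (convex_closedBall (0 : E) 1).linear_preimage Λ
    simpa [Set.preimage, Metric.closedBall] using this
  have hscale : ∀ ⦃x y : ℝ⦄, 0 < x → x ≤ y →
      x • {x | ‖Λ x‖ ≤ 1} ⊆ y • {x | ‖Λ x‖ ≤ 1} := by
    intro x y hx hxy a ha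
    have hy := hx.trans_le hxy
    rw [Set.mem_smul_set_iff_inv_smul_mem₀ hx.ne'] at ha
    rw [Set.mem_smul_set_iff_inv_smul_mem₀ hy.ne']
    simp only [Set.mem_ofPred_eq, map_smul, norm_smul, norm_inv, Real.norm_eq_abs, abs_of_pos hx,
      abs_of_pos hy] at ha ⊢
    refine le_trans ?_ ha
    gcongr
  refine (tendsto_card_div_pow_atTop_volume' {x | ‖Λ x‖ ≤ 1} (isBounded_preimage_ball hΛ)
    hclosed.measurableSet (hconv.addHaar_frontier _) hscale).congr' ?_
  filter_upwards [eventually_gt_atTop 0] with r hr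
  congr 2
  rw [Nat.card_coe_set_eq]
  symm
  refine Set.ncard_congr (fun z _ => r⁻¹ • fun i => (z i : ℝ)) ?_ ?_ ?_
  · intro z hz
    refine ⟨?_, Set.smul_mem_smul_set ?_⟩
    · simp only [affineBallPoints, add_zero, Set.mem_ofPred_eq] at hz
      simp only [Set.mem_ofPred_eq, map_smul, norm_smul, norm_inv, Real.norm_eq_abs, abs_of_pos hr]
      rw [inv_mul_le_iff₀ hr, mul_one]
      exact hz
    · rw [SetLike.mem_coe, Module.Basis.mem_span_iff_repr_mem]
      intro i
      simp
  · intro z w _ _ h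
    have := smul_right_injective (ι → ℝ) (inv_ne_zero hr.ne') h
    funext i
    exact_mod_cast congrFun this i
  · rintro x ⟨hx, y, hy, rfl⟩
    rw [SetLike.mem_coe, Module.Basis.mem_span_iff_repr_mem] at hy
    choose z hz using hy
    have hzy : (fun i => (z i : ℝ)) = y := by
      funext i
      simpa using hz i
    refine ⟨z, ?_, by simp only [hzy]⟩
    simp only [Set.mem_ofPred_eq, map_smul, norm_smul, norm_inv, Real.norm_eq_abs,
      abs_of_pos hr] at hx
    rw [inv_mul_le_iff₀ hr, mul_one] at hx
    simpa [affineBallPoints, hzy] using hx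

theorem tendsto_add_div_pow {f : ℝ → ℝ} {l : ℝ} {d : ℕ}
    (h : Tendsto (fun r : ℝ => f r / r ^ d) atTop (𝓝 l)) (C : ℝ) :
    Tendsto (fun r : ℝ => f (r + C) / r ^ d) atTop (𝓝 l) := by
  have h1 := h.comp (tendsto_atTop_add_const_right atTop C tendsto_id)
  have h2 : Tendsto (fun r : ℝ => ((r + C) / r) ^ d) atTop (𝓝 (1 ^ d)) := by
    refine Tendsto.pow ?_ d
    have : Tendsto (fun r : ℝ => 1 + C / r) atTop (𝓝 (1 + 0)) :=
      tendsto_const_nhds.add (tendsto_const_nhds.div_atTop tendsto_id)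
    rw [add_zero] at this
    refine this.congr' ?_
    filter_upwards [eventually_gt_atTop 0] with r hr
    field_simp
  have h3 := h1.mul h2
  rw [one_pow, mul_one] at h3
  refine h3.congr' ?_
  filter_upwards [eventually_gt_atTop 0, eventually_gt_atTop (-C)] with r hr hr'
  have : r + C ≠ 0 := by linarith
  simp only [Function.comp_apply, id_eq, div_pow]
  field_simp

/-- The translation changes norms by at most `‖v‖`, so the count lies between the linear counts at
radii `r - ‖v‖` and `r + ‖v‖`. -/
theorem tendsto_ncard_affine (hΛ : Function.Injective Λ) (v : E) :
    Tendsto (fun r : ℝ => ((affineBallPoints Λ v r).ncard : ℝ) / r ^ Fintype.card ι) atTop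
      (𝓝 (ballVolume Λ)) := by
  have h := tendsto_ncard_linear hΛ
  refine tendsto_of_tendsto_of_tendsto_of_le_of_le' (tendsto_add_div_pow h (-‖v‖))
    (tendsto_add_div_pow h ‖v‖) ?_ ?_
  all_goals
    filter_upwards [eventually_gt_atTop 0] with r hr
    gcongr
    · exact finite_affineBallPoints hΛ _ _
    intro z hz
    simp only [affineBallPoints, add_zero, Set.mem_ofPred_eq] at hz ⊢
  · linarith [norm_add_le (Λ fun i => (z i : ℝ)) v]
  · have := norm_sub_le (Λ (fun i => (z i : ℝ)) + v) v
    rw [add_sub_cancel_right] at this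
    linarith

theorem tendsto_ncard_dvd (hΛ : Function.Injective Λ) (v : E) {M : ℕ} (hM : 0 < M) :
    Tendsto (fun r : ℝ => ({z ∈ affineBallPoints Λ v r | ∀ i, (M : ℤ) ∣ z i}.ncard : ℝ) /
      r ^ Fintype.card ι) atTop (𝓝 (ballVolume Λ / (M : ℝ) ^ Fintype.card ι)) := by
  have hM' : (0 : ℝ) < M := mod_cast hM
  have h := ((tendsto_ncard_affine hΛ ((M : ℝ)⁻¹ • v)).comp
    (tendsto_id.atTop_div_const hM')).div_const ((M : ℝ) ^ Fintype.card ι)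
  refine h.congr fun r => ?_
  rw [sep_dvd_affineBallPoints Λ v r hM,
    Set.ncard_image_of_injective _ (mul_left_pi_injective hM)]
  simp only [Function.comp_apply, id_eq, div_pow]
  field_simp

/-- Induction on `S` with `M` free: sifting by a new prime `a` subtracts, from the count for `M`,
the count for `M * a ^ k`. Coprimality of `M` to `S` lets the two divisibility conditions merge into
one. -/
theorem tendsto_ncard_sieve (hΛ : Function.Injective Λ) (v : E) (k : ℕ) (S : Finset ℕ)
    (hS : ∀ q ∈ S, q.Prime) {M : ℕ} (hM : 0 < M) (hcop : ∀ q ∈ S, M.Coprime q) :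
    Tendsto (fun r : ℝ => ({z ∈ affineBallPoints Λ v r | (∀ i, (M : ℤ) ∣ z i) ∧
      ∀ q ∈ S, ¬ ∀ i, (q : ℤ) ^ k ∣ z i}.ncard : ℝ) / r ^ Fintype.card ι) atTop
      (𝓝 (ballVolume Λ / (M : ℝ) ^ Fintype.card ι *
        ∏ q ∈ S, (1 - 1 / (q : ℝ) ^ (k * Fintype.card ι)))) := by
  classical
  induction S using Finset.induction_on generalizing M with
  | empty => simpa using tendsto_ncard_dvd hΛ v hM
  | insert a S ha ih =>
    have hap : a.Prime := hS a (Finset.mem_insert_self a S)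
    have hS' : ∀ q ∈ S, q.Prime := fun q hq => hS q (Finset.mem_insert_of_mem hq)
    have hak : 0 < a ^ k := pow_pos hap.pos k
    have h1 := ih hS' hM fun q hq => hcop q (Finset.mem_insert_of_mem hq)
    have h2 := ih hS' (M := M * a ^ k) (Nat.mul_pos hM hak) fun q hq =>
      Nat.Coprime.mul_left (hcop q (Finset.mem_insert_of_mem hq)) (Nat.Coprime.pow_left k
        ((Nat.coprime_primes hap (hS' q hq)).mpr fun h => ha (h ▸ hq)))
    have h3 := h1.sub h2
    have hlim : ballVolume Λ / (M : ℝ) ^ Fintype.card ι *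
          ∏ q ∈ S, (1 - 1 / (q : ℝ) ^ (k * Fintype.card ι)) -
        ballVolume Λ / ((M * a ^ k : ℕ) : ℝ) ^ Fintype.card ι *
          ∏ q ∈ S, (1 - 1 / (q : ℝ) ^ (k * Fintype.card ι)) =
        ballVolume Λ / (M : ℝ) ^ Fintype.card ι *
          ∏ q ∈ insert a S, (1 - 1 / (q : ℝ) ^ (k * Fintype.card ι)) := by
      rw [Finset.prod_insert ha]
      push_cast
      have : (a : ℝ) ≠ 0 := mod_cast hap.ne_zero
      have : (M : ℝ) ≠ 0 := mod_cast hM.ne'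
      rw [mul_pow, ← pow_mul]
      field_simp
    rw [hlim] at h3
    refine h3.congr fun r => ?_
    rw [← sub_div]
    congr 1
    have hcop' : IsCoprime (M : ℤ) ((a : ℤ) ^ k) :=
      (Nat.isCoprime_iff_coprime.mpr (hcop a (Finset.mem_insert_self a S))).pow_right
    have hdvd : ∀ x : ℤ, ((M * a ^ k : ℕ) : ℤ) ∣ x ↔ (M : ℤ) ∣ x ∧ (a : ℤ) ^ k ∣ x := by
      intro x
      push_cast
      exact ⟨fun h => ⟨dvd_of_mul_right_dvd h, dvd_of_mul_left_dvd h⟩,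
        fun h => hcop'.mul_dvd h.1 h.2⟩
    have hsub : {z ∈ affineBallPoints Λ v r | (∀ i, ((M * a ^ k : ℕ) : ℤ) ∣ z i) ∧
        ∀ q ∈ S, ¬ ∀ i, (q : ℤ) ^ k ∣ z i} ⊆
        {z ∈ affineBallPoints Λ v r | (∀ i, (M : ℤ) ∣ z i) ∧
        ∀ q ∈ S, ¬ ∀ i, (q : ℤ) ^ k ∣ z i} :=
      fun z hz => ⟨hz.1, fun i => ((hdvd _).mp (hz.2.1 i)).1, hz.2.2⟩
    have hfin := (finite_affineBallPoints hΛ v r).subset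
      (Set.sep_subset _ fun z => (∀ i, (M : ℤ) ∣ z i) ∧ ∀ q ∈ S, ¬ ∀ i, (q : ℤ) ^ k ∣ z i)
    have hcard := Set.ncard_sdiff_add_ncard_of_subset hsub hfin
    rw [sub_eq_iff_eq_add, ← hcard, Nat.cast_add]
    congr 3
    ext z
    simp only [Set.mem_sdiff, Set.mem_ofPred_eq, hdvd, Finset.mem_insert, forall_eq_or_imp,
      forall_and]
    tauto

/-- For small `r` the origin is the only point. Leaving it out gives a bound with no additive
constant, valid for every `r > 0`; it will be used at radius `r / M` with `M` arbitrarily large. -/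
theorem exists_ncard_ne_zero_le (hΛ : Function.Injective Λ) :
    ∃ C : ℝ, 0 < C ∧ ∀ r : ℝ, 0 < r →
      ({z ∈ affineBallPoints Λ 0 r | z ≠ 0}.ncard : ℝ) ≤ C * r ^ Fintype.card ι := by
  obtain ⟨c, hc, h⟩ := exists_pos_norm_le_mul Λ hΛ
  refine ⟨(3 * c) ^ Fintype.card ι, by positivity, fun r hr => ?_⟩
  have hle : ∀ z ∈ affineBallPoints Λ 0 r, ‖(fun i => (z i : ℝ))‖ ≤ c * r := fun z hz => by
    refine (h _).trans (mul_le_mul_of_nonneg_left ?_ hc.le)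
    simpa [affineBallPoints] using hz
  by_cases hcr : 1 ≤ c * r
  · rw [← mul_pow, mul_assoc]
    have hsub : {z ∈ affineBallPoints Λ 0 r | z ≠ 0} ⊆
        {z : ι → ℤ | ‖(fun i => (z i : ℝ))‖ ≤ c * r} := fun z hz => hle z hz.1
    refine le_trans ?_ (ncard_norm_intCast_le hcr)
    exact_mod_cast Set.ncard_le_ncard hsub (finite_norm_intCast_le _)
  · have : {z ∈ affineBallPoints Λ 0 r | z ≠ 0} = ∅ := by
      refine Set.eq_empty_of_forall_notMem fun z hz => hz.2 (funext fun i => ?_)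
      have h1 := (norm_le_pi_norm (fun i => (z i : ℝ)) i).trans (hle z hz.1)
      have h2 : |(z i : ℝ)| < 1 := by rw [← Real.norm_eq_abs]; linarith
      exact Int.abs_lt_one_iff.mp (by exact_mod_cast h2)
    rw [this, Set.ncard_empty]
    push_cast
    positivity

end Counting

/-! ### Infinite products with factors in `[0, 1]`. -/

section InfiniteProduct

variable {α : Type*} {f : α → ℝ}

theorem antitone_finset_prod (h0 : ∀ a, 0 ≤ f a) (h1 : ∀ a, f a ≤ 1) :
    Antitone fun s : Finset α => ∏ a ∈ s, f a := fun s t hst => by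
  classical
  change ∏ a ∈ t, f a ≤ ∏ a ∈ s, f a
  rw [← Finset.prod_sdiff hst]
  exact mul_le_of_le_one_left (Finset.prod_nonneg fun a _ => h0 a)
    (Finset.prod_le_one (fun a _ => h0 a) fun a _ => h1 a)

theorem multipliable_of_mem_Icc (h0 : ∀ a, 0 ≤ f a) (h1 : ∀ a, f a ≤ 1) : Multipliable f :=
  ⟨_, tendsto_atTop_ciInf (antitone_finset_prod h0 h1)
    ⟨0, by rintro _ ⟨s, rfl⟩; exact Finset.prod_nonneg fun a _ => h0 a⟩⟩

theorem tprod_le_finset_prod (h0 : ∀ a, 0 ≤ f a) (h1 : ∀ a, f a ≤ 1) (s : Finset α) :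
    ∏' a, f a ≤ ∏ a ∈ s, f a :=
  (antitone_finset_prod h0 h1).le_of_tendsto (multipliable_of_mem_Icc h0 h1).hasProd s

/-- By `1 - x ≤ exp (-x)`, every finite sum is at most minus the logarithm of the product. -/
theorem summable_of_tprod_one_sub_pos {g : α → ℝ} (h0 : ∀ a, 0 ≤ g a) (h1 : ∀ a, g a ≤ 1)
    (hpos : 0 < ∏' a, (1 - g a)) : Summable g := by
  refine summable_of_sum_le (c := -Real.log (∏' a, (1 - g a))) h0 fun s => ?_
  have h2 : ∏' a, (1 - g a) ≤ Real.exp (-∑ a ∈ s, g a) := by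
    rw [← Finset.sum_neg_distrib, Real.exp_sum]
    refine (tprod_le_finset_prod (f := fun a => 1 - g a) (fun a => sub_nonneg.mpr (h1 a))
      (fun a => sub_le_self _ (h0 a)) s).trans ?_
    exact Finset.prod_le_prod (fun a _ => sub_nonneg.mpr (h1 a))
      fun a _ => Real.one_sub_le_exp_neg (g a)
  have := (Real.log_le_iff_le_exp hpos).mpr h2
  linarith

end InfiniteProduct

/-! ### Density of the sifted points, for finite and infinite sets of primes. -/

section Density

variable {ι : Type*} [Fintype ι] {E : Type*} [NormedAddCommGroup E] [NormedSpace ℝ E]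
  {Λ : (ι → ℝ) →ₗ[ℝ] E}

/-- The points of `affineBallPoints Λ v r` which are not divisible by `q ^ k` for any `q ∈ I`. -/
def siftedPoints (Λ : (ι → ℝ) →ₗ[ℝ] E) (v : E) (k : ℕ) (I : Set ℕ) (r : ℝ) : Set (ι → ℤ) :=
  {z ∈ affineBallPoints Λ v r | ∀ q ∈ I, ¬ ∀ i, (q : ℤ) ^ k ∣ z i}

theorem finite_siftedPoints (hΛ : Function.Injective Λ) (v : E) (k : ℕ) (I : Set ℕ) (r : ℝ) :
    (siftedPoints Λ v k I r).Finite :=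
  (finite_affineBallPoints hΛ v r).subset (Set.sep_subset _ _)

theorem tendsto_siftedPoints_finset (hΛ : Function.Injective Λ) (v : E) (k : ℕ) (S : Finset ℕ)
    (hS : ∀ q ∈ S, q.Prime) :
    Tendsto (fun r : ℝ => ((siftedPoints Λ v k S r).ncard : ℝ) / (affineBallPoints Λ v r).ncard)
      atTop (𝓝 (∏ q ∈ S, (1 - 1 / (q : ℝ) ^ (k * Fintype.card ι)))) := by
  have hpos := ballVolume_pos hΛ
  have h := (tendsto_ncard_sieve hΛ v k S hS one_pos fun q _ => Nat.coprime_one_left q).div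
    (tendsto_ncard_affine hΛ v) hpos.ne'
  have hlim : ballVolume Λ / ((1 : ℕ) : ℝ) ^ Fintype.card ι *
      (∏ q ∈ S, (1 - 1 / (q : ℝ) ^ (k * Fintype.card ι))) / ballVolume Λ =
      ∏ q ∈ S, (1 - 1 / (q : ℝ) ^ (k * Fintype.card ι)) := by
    rw [Nat.cast_one, one_pow, div_one, mul_div_cancel_left₀ _ hpos.ne']
  rw [hlim] at h
  refine h.congr' ?_
  filter_upwards [eventually_gt_atTop 0] with r hr
  rw [Pi.div_apply, div_div_div_cancel_right₀ (by positivity)]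
  congr 3
  ext z
  simp [siftedPoints]

/-- Division by `M` maps these points to nonzero points at radius `r / M` for the same `Λ`, because
there is no translation to rescale. Hence `C` does not depend on `M`. -/
theorem exists_ncard_dvd_ne_zero_le (hΛ : Function.Injective Λ) :
    ∃ C : ℝ, 0 < C ∧ ∀ r : ℝ, 0 < r → ∀ M : ℕ, 0 < M →
      ({z ∈ affineBallPoints Λ 0 r | z ≠ 0 ∧ ∀ i, (M : ℤ) ∣ z i}.ncard : ℝ) ≤
        C * r ^ Fintype.card ι * (1 / (M : ℝ) ^ Fintype.card ι) := by
  obtain ⟨C, hC, h⟩ := exists_ncard_ne_zero_le hΛ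
  refine ⟨C, hC, fun r hr M hM => ?_⟩
  have hM' : (0 : ℝ) < M := mod_cast hM
  have hsub : {z ∈ affineBallPoints Λ 0 r | z ≠ 0 ∧ ∀ i, (M : ℤ) ∣ z i} ⊆
      (fun (w : ι → ℤ) i => (M : ℤ) * w i) '' {w ∈ affineBallPoints Λ 0 (r / M) | w ≠ 0} := by
    rintro z ⟨hz, hz0, hd⟩
    have hz' : z ∈ {z ∈ affineBallPoints Λ 0 r | ∀ i, (M : ℤ) ∣ z i} := ⟨hz, hd⟩
    rw [sep_dvd_affineBallPoints Λ 0 r hM, smul_zero] at hz'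
    obtain ⟨w, hw, rfl⟩ := hz'
    refine ⟨w, ⟨hw, ?_⟩, rfl⟩
    rintro rfl
    exact hz0 (funext fun i => mul_zero _)
  have hfin : {w ∈ affineBallPoints Λ 0 (r / M) | w ≠ 0}.Finite :=
    (finite_affineBallPoints hΛ 0 _).subset (Set.sep_subset _ _)
  have h1 := (Set.ncard_le_ncard hsub (hfin.image _)).trans (Set.ncard_image_le hfin)
  refine (Nat.cast_le.mpr h1).trans ((h (r / M) (by positivity)).trans_eq ?_)
  rw [div_pow]
  ring

/-- The tail estimate: a point that survives `S` but not `I` is the origin, which accounts for the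
`1`, or is a nonzero point divisible by `q ^ k` for some `q ∈ I` outside `S`. -/
theorem exists_finset_ncard_siftedPoints_le (hΛ : Function.Injective Λ) (k : ℕ) (I : Set ℕ)
    (hI : ∀ q ∈ I, q.Prime)
    (hsum : Summable fun q : I => 1 / ((q : ℕ) : ℝ) ^ (k * Fintype.card ι)) {ε : ℝ} (hε : 0 < ε) :
    ∃ S : Finset ℕ, ↑S ⊆ I ∧ ∀ r : ℝ, 0 < r →
      ((siftedPoints Λ 0 k S r).ncard : ℝ) ≤
        (siftedPoints Λ 0 k I r).ncard + 1 + ε * r ^ Fintype.card ι := by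
  classical
  obtain ⟨C, hC, hcount⟩ := exists_ncard_dvd_ne_zero_le hΛ
  obtain ⟨S, hS⟩ := summable_iff_vanishing_norm.mp hsum (ε / C) (by positivity)
  refine ⟨S.map (Function.Embedding.subtype _), by simp, fun r hr => ?_⟩
  set S' : Finset ℕ := S.map (Function.Embedding.subtype _) with hS'
  let B : I → Set (ι → ℤ) := fun q =>
    {z ∈ affineBallPoints Λ 0 r | z ≠ 0 ∧ ∀ i, (((q : ℕ) ^ k : ℕ) : ℤ) ∣ z i}
  have hfin := finite_affineBallPoints hΛ 0 r
  let W : Set (ι → ℤ) := {z ∈ affineBallPoints Λ 0 r | ∃ q : I, q ∉ S ∧ z ∈ B q}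
  have hW : W.Finite := hfin.subset (Set.sep_subset _ _)
  have hWle : (W.ncard : ℝ) ≤ ε * r ^ Fintype.card ι := by
    have hch : ∀ z : W, ∃ q : I, q ∉ S ∧ (z : ι → ℤ) ∈ B q := fun z => z.2.2
    choose q hqS hqB using hch
    have : Fintype W := hW.fintype
    -- One prime is picked for each of the finitely many points of `W`, so that finitely many sets
    -- `B q` cover `W` and the vanishing criterion applies to a finite set disjoint from `S`.
    let T : Finset I := Finset.univ.image q
    have hTS : Disjoint T S := by
      refine Finset.disjoint_left.mpr fun a ha => ?_
      obtain ⟨z, -, rfl⟩ := Finset.mem_image.mp ha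
      exact hqS z
    have hWT : W ⊆ ⋃ a ∈ T, B a := fun z hz => Set.mem_biUnion
      (Finset.mem_coe.mpr (Finset.mem_image_of_mem q (Finset.mem_univ ⟨z, hz⟩))) (hqB ⟨z, hz⟩)
    have hBfin : (⋃ a ∈ T, B a).Finite :=
      hfin.subset (Set.iUnion₂_subset fun a _ => Set.sep_subset _ _)
    have h1 : W.ncard ≤ ∑ a ∈ T, (B a).ncard :=
      (Set.ncard_le_ncard hWT hBfin).trans (Finset.set_ncard_biUnion_le _ _)
    have h2 : ∑ a ∈ T, ((B a).ncard : ℝ) ≤ ∑ a ∈ T, C * r ^ Fintype.card ι *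
        (1 / ((a : ℕ) : ℝ) ^ (k * Fintype.card ι)) := by
      refine Finset.sum_le_sum fun a _ => ?_
      have := hcount r hr ((a : ℕ) ^ k) (pow_pos (hI a a.2).pos k)
      have hc : (((a : ℕ) ^ k : ℕ) : ℝ) ^ Fintype.card ι =
          ((a : ℕ) : ℝ) ^ (k * Fintype.card ι) := by rw [Nat.cast_pow, pow_mul]
      rwa [hc] at this
    have h3 := (le_abs_self _).trans (hS T hTS).le
    rw [← Finset.mul_sum] at h2
    calc (W.ncard : ℝ) ≤ ∑ a ∈ T, ((B a).ncard : ℝ) := mod_cast h1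
      _ ≤ C * r ^ Fintype.card ι * (ε / C) := h2.trans (by gcongr)
      _ = ε * r ^ Fintype.card ι := by field_simp
  have hsub : siftedPoints Λ 0 k S' r ⊆ (siftedPoints Λ 0 k I r ∪ {0}) ∪ W := by
    rintro z ⟨hz, hzS⟩
    by_cases h0 : z = 0
    · exact Or.inl (Or.inr h0)
    by_cases hzI : ∀ q ∈ I, ¬ ∀ i, (q : ℤ) ^ k ∣ z i
    · exact Or.inl (Or.inl ⟨hz, hzI⟩)
    · push Not at hzI
      obtain ⟨q, hq, hd⟩ := hzI
      refine Or.inr ⟨hz, ⟨q, hq⟩, fun hqS => hzS q ?_ hd, hz, h0, by simpa using hd⟩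
      simpa [hS'] using ⟨hq, hqS⟩
  have hle := Set.ncard_le_ncard hsub
    (((finite_siftedPoints hΛ 0 k I r).union (Set.finite_singleton 0)).union hW)
  have hu1 := Set.ncard_union_le (siftedPoints Λ 0 k I r ∪ {0}) W
  have hu2 := Set.ncard_union_le (siftedPoints Λ 0 k I r) {0}
  rw [Set.ncard_singleton] at hu2
  have : (siftedPoints Λ 0 k S' r).ncard ≤ (siftedPoints Λ 0 k I r).ncard + 1 + W.ncard := by lia
  have : ((siftedPoints Λ 0 k S' r).ncard : ℝ) ≤
    (siftedPoints Λ 0 k I r).ncard + 1 + W.ncard := mod_cast this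
  linarith

theorem tendsto_siftedPoints (hΛ : Function.Injective Λ) (v : E) (k : ℕ) (I : Set ℕ)
    (hI : ∀ q ∈ I, q.Prime) (h : I.Finite ∨ k = 0 ∨ v = 0) :
    Tendsto (fun r : ℝ => ((siftedPoints Λ v k I r).ncard : ℝ) / (affineBallPoints Λ v r).ncard)
      atTop (𝓝 (∏' q : I, (1 - 1 / ((q : ℕ) : ℝ) ^ (k * Fintype.card ι)))) := by
  classical
  by_cases hfin : I.Finite
  · lift I to Finset ℕ using hfin
    have := tendsto_siftedPoints_finset hΛ v k I hI
    rwa [← Finset.tprod_subtype I fun q => 1 - 1 / (q : ℝ) ^ (k * Fintype.card ι)] at this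
  replace h := h.resolve_left hfin
  set g : I → ℝ := fun q => 1 / ((q : ℕ) : ℝ) ^ (k * Fintype.card ι) with hg
  have hg0 : ∀ q, 0 ≤ g q := fun q => by positivity
  have hg1 : ∀ q, g q ≤ 1 := fun q => by
    have : (1 : ℝ) ≤ (q : ℕ) := mod_cast (hI q q.2).one_le
    exact div_le_one_of_le₀ (one_le_pow₀ this) (by positivity)
  have hf0 : ∀ q, 0 ≤ 1 - g q := fun q => sub_nonneg.mpr (hg1 q)
  have hf1 : ∀ q, 1 - g q ≤ 1 := fun q => sub_le_self _ (hg0 q)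
  refine tendsto_order.mpr ⟨fun a ha => ?_, fun a ha => ?_⟩
  · rcases lt_or_ge a 0 with ha0 | ha0
    · exact Eventually.of_forall fun r => ha0.trans_le (by positivity)
    -- Here the product exceeds `a ≥ 0`, hence is positive. Summability over an infinite `I`
    -- excludes `k * d = 0`, where `d = Fintype.card ι`, and this leaves `v = 0`.
    have hsum := summable_of_tprod_one_sub_pos hg0 hg1 (ha0.trans_lt ha)
    have hkd : k * Fintype.card ι ≠ 0 := by
      intro h0
      have : Infinite I := Set.infinite_coe_iff.mpr hfin
      simp [hg, h0, summable_const_iff] at hsum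
    have hd : Fintype.card ι ≠ 0 := (mul_ne_zero_iff.mp hkd).2
    obtain rfl : v = 0 := h.resolve_left (mul_ne_zero_iff.mp hkd).1
    have hpos := ballVolume_pos hΛ
    -- The count of all points is about `ballVolume Λ * r ^ d`, so this `ε` costs half of the gap
    -- between the product and `a`.
    obtain ⟨S, hSI, hS⟩ := exists_finset_ncard_siftedPoints_le hΛ k I hI hsum
      (ε := (∏' q, (1 - g q) - a) / 2 * ballVolume Λ)
      (mul_pos (half_pos (sub_pos.mpr ha)) hpos)
    set ε := (∏' q, (1 - g q) - a) / 2 * ballVolume Λ with hε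
    have hN := tendsto_ncard_affine hΛ (0 : E)
    have herr : Tendsto (fun r : ℝ => (1 + ε * r ^ Fintype.card ι) /
        (affineBallPoints Λ 0 r).ncard) atTop (𝓝 ((0 + ε) / ballVolume Λ)) := by
      have h1 : Tendsto (fun r : ℝ => (r ^ Fintype.card ι)⁻¹ + ε) atTop (𝓝 (0 + ε)) :=
        (tendsto_inv_atTop_zero.comp (tendsto_pow_atTop hd)).add_const ε
      refine (h1.div hN hpos.ne').congr' ?_
      filter_upwards [eventually_gt_atTop 0] with r hr
      have : (0 : ℝ) < r ^ Fintype.card ι := by positivity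
      rw [Pi.div_apply, ← div_div_div_cancel_right₀ this.ne' (1 + _)]
      congr 1
      field_simp
    have hlow := (tendsto_siftedPoints_finset hΛ (0 : E) k S fun q hq => hI q (hSI hq)).sub herr
    have hPS : ∏' q, (1 - g q) ≤ ∏ q ∈ S, (1 - 1 / (q : ℝ) ^ (k * Fintype.card ι)) := by
      refine (tprod_le_finset_prod hf0 hf1 (S.subtype (· ∈ I))).trans_eq ?_
      exact Finset.prod_subtype_of_mem
        (fun q : ℕ => 1 - 1 / (q : ℝ) ^ (k * Fintype.card ι)) fun q hq => hSI hq
    have hlt : a < ∏ q ∈ S, (1 - 1 / (q : ℝ) ^ (k * Fintype.card ι)) -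
        (0 + ε) / ballVolume Λ := by
      rw [zero_add, hε, mul_div_cancel_right₀ _ hpos.ne']
      linarith
    filter_upwards [hlow.eventually_const_lt hlt, eventually_gt_atTop 0] with r hr hr0
    refine hr.trans_le ?_
    rw [← sub_div]
    gcongr
    linarith [hS r hr0]
  -- Upper bound: some finite partial product is already below `a`, and sifting by more primes only
  -- removes points.
  · obtain ⟨S, hS⟩ := ((multipliable_of_mem_Icc hf0 hf1).hasProd.eventually_lt_const ha).exists
    have hmap := tendsto_siftedPoints_finset hΛ v k (S.map (Function.Embedding.subtype _))
      (by simpa using fun q hq _ => hI q hq)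
    rw [Finset.prod_map] at hmap
    filter_upwards [hmap.eventually_lt_const hS] with r hr
    refine lt_of_le_of_lt ?_ hr
    gcongr
    · exact finite_siftedPoints hΛ v k _ r
    · exact fun z hz => ⟨hz.1, fun q hq => hz.2 q (by simp at hq; exact hq.1)⟩

end Density

/-! ### Kernel and rank of a matrix in Smith normal form. -/

section Smith

variable {s n : ℕ} {D : Matrix (Fin s) (Fin n) ℤ}

/-- The columns of `D` that have a nonzero diagonal entry. -/
def pivots (D : Matrix (Fin s) (Fin n) ℤ) : Set (Fin n) :=
  {j | ∃ i : Fin s, (i : ℕ) = (j : ℕ) ∧ D i j ≠ 0}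

theorem IsSmithNormalForm.mulVec_apply (hD : IsSmithNormalForm D) (y : Fin n → ℤ) {i : Fin s}
    {j : Fin n} (hij : (i : ℕ) = j) : (D *ᵥ y) i = D i j * y j := by
  rw [Matrix.mulVec, dotProduct]
  exact Finset.sum_eq_single j
    (fun b _ hb => by
      rw [show D i b = 0 from hD.off_diag i b fun h => hb (Fin.ext (h.symm.trans hij)), zero_mul])
    fun h => absurd (Finset.mem_univ j) h

theorem IsSmithNormalForm.mulVec_eq_zero_iff (hD : IsSmithNormalForm D) (y : Fin n → ℤ) :
    D *ᵥ y = 0 ↔ ∀ j ∈ pivots D, y j = 0 := by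
  constructor
  · rintro h j ⟨i, hij, hne⟩
    have := congrFun h i
    rw [hD.mulVec_apply y hij] at this
    exact (mul_eq_zero.mp this).resolve_left hne
  · intro h
    funext i
    by_cases hi : (i : ℕ) < n
    · rw [hD.mulVec_apply y (j := ⟨i, hi⟩) rfl]
      by_cases h0 : D i ⟨i, hi⟩ = 0
      · simp [h0]
      · simp [h ⟨i, hi⟩ ⟨i, rfl, h0⟩]
    · rw [Matrix.mulVec, dotProduct]
      exact Finset.sum_eq_zero fun j _ => by
        rw [show D i j = 0 from hD.off_diag i j fun h => hi (h ▸ j.2), zero_mul]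

theorem IsSmithNormalForm.mulVec_eq_iff (hD : IsSmithNormalForm D) (y w : Fin n → ℤ) :
    D *ᵥ y = D *ᵥ w ↔ ∀ j ∈ pivots D, y j = w j := by
  rw [← sub_eq_zero, ← Matrix.mulVec_sub, hD.mulVec_eq_zero_iff]
  simp [sub_eq_zero]

/-- A zero on the diagonal divides the next entry, so all later entries vanish as well. -/
theorem IsSmithNormalForm.isLowerSet_pivots (hD : IsSmithNormalForm D) :
    IsLowerSet (pivots D) := by
  have key : ∀ d : ℕ, ∀ a b : Fin n, (a : ℕ) + d = b → b ∈ pivots D → a ∈ pivots D := by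
    intro d
    induction d with
    | zero =>
      intro a b hab hb
      obtain rfl : a = b := Fin.ext (by simpa using hab)
      exact hb
    | succ d ih =>
      rintro a b hab ⟨i, hi, hne⟩
      have hib := i.2
      have hbn := b.2
      refine ih a ⟨a + d, by lia⟩ rfl ⟨⟨a + d, by lia⟩, rfl, fun h0 => hne ?_⟩
      have := hD.dvd_succ ⟨a + d, by lia⟩ i ⟨a + d, by lia⟩ b rfl hi (by simp only; lia)
      rw [h0] at this
      exact zero_dvd_iff.mp this
  intro b a hab hb
  exact key (b - a) a b (by have : (a : ℕ) ≤ b := hab; lia) hb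

/-- Rank–nullity over `ℤ`: restriction to the non-pivot columns identifies the kernel with the free
module on them. -/
theorem IsSmithNormalForm.rank_add_card (hD : IsSmithNormalForm D)
    [Fintype {j : Fin n // j ∉ pivots D}] :
    D.rank + Fintype.card {j : Fin n // j ∉ pivots D} = n := by
  classical
  let φ : LinearMap.ker D.mulVecLin →ₗ[ℤ] ({j : Fin n // j ∉ pivots D} → ℤ) :=
    (LinearMap.funLeft ℤ ℤ Subtype.val).comp (Submodule.subtype _)
  have hker : ∀ y : Fin n → ℤ, y ∈ LinearMap.ker D.mulVecLin ↔ ∀ j ∈ pivots D, y j = 0 :=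
    fun y => by rw [LinearMap.mem_ker, Matrix.mulVecLin_apply, hD.mulVec_eq_zero_iff]
  have hφ : Function.Bijective φ := by
    constructor
    · intro y w h
      ext j
      by_cases hj : j ∈ pivots D
      · rw [(hker _).mp y.2 j hj, (hker _).mp w.2 j hj]
      · exact congrFun h ⟨j, hj⟩
    · intro u
      refine ⟨⟨fun j => if hj : j ∈ pivots D then 0 else u ⟨j, hj⟩,
        (hker _).mpr fun j hj => by simp [hj]⟩, ?_⟩
      funext j
      simp [φ, LinearMap.funLeft_apply, j.2]
  have h := Submodule.finrank_quotient_add_finrank (LinearMap.ker D.mulVecLin)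
  rw [D.mulVecLin.quotKerEquivRange.finrank_eq] at h
  rw [(LinearEquiv.ofBijective φ hφ).finrank_eq, Module.finrank_fintype_fun_eq_card,
    Module.finrank_fintype_fun_eq_card, Fintype.card_fin] at h
  exact h

theorem mem_iff_lt_ncard_of_isLowerSet {J : Set (Fin n)} (hJ : IsLowerSet J) (j : Fin n) :
    j ∈ J ↔ (j : ℕ) < J.ncard := by
  constructor
  · intro hj
    have h1 := Set.ncard_le_ncard (s := Set.Iic j) (fun a ha => hJ ha hj) J.toFinite
    rw [← Finset.coe_Iic, Set.ncard_coe_finset, Fin.card_Iic] at h1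
    lia
  · intro h
    by_contra hj
    have h1 := Set.ncard_le_ncard (s := J) (t := Set.Iio j)
      (fun a ha => not_le.mp fun hle => hj (hJ hle ha)) (Set.toFinite _)
    rw [← Finset.coe_Iio, Set.ncard_coe_finset, Fin.card_Iio] at h1
    lia

theorem IsSmithNormalForm.mem_pivots_iff (hD : IsSmithNormalForm D) (j : Fin n) :
    j ∈ pivots D ↔ (j : ℕ) < D.rank := by
  classical
  have h1 := hD.rank_add_card
  have h2 := Set.ncard_add_ncard_compl (pivots D)
  rw [Nat.card_fin, ← Nat.card_coe_set_eq (pivots D)ᶜ, Nat.card_eq_fintype_card] at h2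
  have h3 : Fintype.card {j : Fin n // j ∉ pivots D} = Fintype.card ((pivots D)ᶜ : Set (Fin n)) :=
    Fintype.card_congr (Equiv.refl _)
  rw [mem_iff_lt_ncard_of_isLowerSet hD.isLowerSet_pivots]
  lia

theorem IsSmithNormalForm.card_le_coe (hD : IsSmithNormalForm D) {m : ℕ} (hm : m = D.rank) :
    Fintype.card {j : Fin n // m ≤ (j : ℕ)} = n - m := by
  classical
  have h1 := hD.rank_add_card
  have h2 : Fintype.card {j : Fin n // m ≤ (j : ℕ)} = Fintype.card {j : Fin n // j ∉ pivots D} :=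
    Fintype.card_congr (Equiv.subtypeEquivRight fun j => by
      rw [hD.mem_pivots_iff, not_lt, hm])
  lia

end Smith

/-! ### Parametrizing the lattice points by their free coordinates. -/

section Parametrization

variable {n : ℕ}

/-- Extend a family indexed by the coordinates `j ≥ m` to all coordinates by zero. -/
def extendZero (R : Type*) [CommRing R] (n m : ℕ) :
    ({j : Fin n // m ≤ (j : ℕ)} → R) →ₗ[R] (Fin n → R) where
  toFun z j := if h : m ≤ (j : ℕ) then z ⟨j, h⟩ else 0
  map_add' z w := by funext j; by_cases h : m ≤ (j : ℕ) <;> simp [h]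
  map_smul' c z := by funext j; by_cases h : m ≤ (j : ℕ) <;> simp [h]

/-- Keep the first `m` coordinates and replace the other ones by zero. -/
def truncate (m : ℕ) (y : Fin n → ℤ) : Fin n → ℤ := fun j => if m ≤ (j : ℕ) then 0 else y j

theorem extendZero_add_truncate_of_le {m : ℕ} (y : Fin n → ℤ)
    (z : {j : Fin n // m ≤ (j : ℕ)} → ℤ) {j : Fin n} (h : m ≤ (j : ℕ)) :
    (extendZero ℤ n m z + truncate m y) j = z ⟨j, h⟩ := by
  simp [extendZero, truncate, h]

theorem extendZero_add_truncate_of_lt {m : ℕ} (y : Fin n → ℤ)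
    (z : {j : Fin n // m ≤ (j : ℕ)} → ℤ) {j : Fin n} (h : (j : ℕ) < m) :
    (extendZero ℤ n m z + truncate m y) j = y j := by
  simp [extendZero, truncate, not_le.mpr h]

/-- The integral vectors with the same first `m` coordinates as `y`, transformed by `W`. -/
def latticeParam (W : Matrix (Fin n) (Fin n) ℤ) (m : ℕ) (y : Fin n → ℤ)
    (z : {j : Fin n // m ≤ (j : ℕ)} → ℤ) : Fin n → ℤ :=
  W *ᵥ (extendZero ℤ n m z + truncate m y)

/-- The linear part of `latticeParam` over the reals. -/
noncomputable def linearParam (W : Matrix (Fin n) (Fin n) ℤ) (m : ℕ) :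
    ({j : Fin n // m ≤ (j : ℕ)} → ℝ) →ₗ[ℝ] (Fin n → ℝ) :=
  (W.map (Int.castRingHom ℝ)).mulVecLin ∘ₗ extendZero ℝ n m

theorem cast_latticeParam (W : Matrix (Fin n) (Fin n) ℤ) (m : ℕ) (y : Fin n → ℤ)
    (z : {j : Fin n // m ≤ (j : ℕ)} → ℤ) :
    (fun j => (latticeParam W m y z j : ℝ)) =
      linearParam W m (fun i => (z i : ℝ)) + fun j => ((W *ᵥ truncate m y) j : ℝ) := by
  funext j
  have : (fun j => ((extendZero ℤ n m z j : ℤ) : ℝ)) = extendZero ℝ n m fun i => (z i : ℝ) := by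
    funext j
    by_cases h : m ≤ (j : ℕ) <;> simp [extendZero, h]
  simp only [latticeParam, linearParam, Matrix.mulVec_add, Pi.add_apply, Int.cast_add,
    LinearMap.comp_apply, Matrix.mulVecLin_apply]
  rw [← this]
  congr 1
  simp [Matrix.mulVec, dotProduct]

theorem mulVec_injective_of_mul_eq_one {R : Type*} [CommRing R] {W W' : Matrix (Fin n) (Fin n) R}
    (h : W' * W = 1) : Function.Injective (W *ᵥ ·) := fun x y hxy => by
  have := congrArg (W' *ᵥ ·) hxy
  simpa [Matrix.mulVec_mulVec, h] using this

theorem extendZero_injective (R : Type*) [CommRing R] (n m : ℕ) :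
    Function.Injective (extendZero R n m) := fun z w h => by
  funext j
  simpa [extendZero, j.2] using congrFun h j

theorem linearParam_injective {W W' : Matrix (Fin n) (Fin n) ℤ} (h : W' * W = 1) (m : ℕ) :
    Function.Injective (linearParam W m) := by
  have h1 : W'.map (Int.castRingHom ℝ) * W.map (Int.castRingHom ℝ) = 1 := by
    rw [← Matrix.map_mul, h, Matrix.map_one _ (map_zero _) (map_one _)]
  exact (mulVec_injective_of_mul_eq_one h1).comp (extendZero_injective ℝ n m)

theorem latticeParam_injective {W W' : Matrix (Fin n) (Fin n) ℤ} (h : W' * W = 1) (m : ℕ)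
    (y : Fin n → ℤ) : Function.Injective (latticeParam W m y) :=
  (mulVec_injective_of_mul_eq_one h).comp
    ((add_left_injective (truncate m y)).comp (extendZero_injective ℤ n m))

theorem range_latticeParam {W W' : Matrix (Fin n) (Fin n) ℤ} (h : W' * W = 1) (m : ℕ)
    (y : Fin n → ℤ) :
    Set.range (latticeParam W m y) = {x | ∀ j : Fin n, (j : ℕ) < m → (W' *ᵥ x) j = y j} := by
  have h' : W * W' = 1 := mul_eq_one_comm.mp h
  ext x
  constructor
  · rintro ⟨z, rfl⟩ j hj
    rw [latticeParam, Matrix.mulVec_mulVec, h, Matrix.one_mulVec,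
      extendZero_add_truncate_of_lt y z hj]
  · intro hx
    refine ⟨fun i => (W' *ᵥ x) i, ?_⟩
    have : extendZero ℤ n m (fun i => (W' *ᵥ x) i) + truncate m y = W' *ᵥ x := by
      funext j
      rcases lt_or_ge (j : ℕ) m with hj | hj
      · rw [extendZero_add_truncate_of_lt _ _ hj, hx j hj]
      · rw [extendZero_add_truncate_of_le _ _ hj]
    rw [latticeParam, this, Matrix.mulVec_mulVec, h', Matrix.one_mulVec]

theorem dvd_mulVec {W : Matrix (Fin n) (Fin n) ℤ} {c : ℤ} {y : Fin n → ℤ} (h : ∀ j, c ∣ y j)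
    (j : Fin n) : c ∣ (W *ᵥ y) j := by
  rw [Matrix.mulVec, dotProduct]
  exact Finset.dvd_sum fun i _ => (h i).mul_left _

/-- Both `W` and its inverse `W'` are integral, so a common divisor of the entries survives
multiplication by either. -/
theorem dvd_latticeParam_iff {W W' : Matrix (Fin n) (Fin n) ℤ} (h : W' * W = 1) (m : ℕ)
    (y : Fin n → ℤ) (z : {j : Fin n // m ≤ (j : ℕ)} → ℤ) (c : ℤ) :
    c ∣ Finset.univ.gcd (latticeParam W m y z) ↔ c ∣ gcdFirst m y ∧ ∀ i, c ∣ z i := by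
  rw [Finset.dvd_gcd_iff, gcdFirst, Finset.dvd_gcd_iff]
  simp only [Finset.mem_univ, true_imp_iff, Finset.mem_filter, true_and]
  constructor
  · intro hx
    have hy : ∀ j, c ∣ (extendZero ℤ n m z + truncate m y) j := by
      have := dvd_mulVec (W := W') hx
      simpa only [latticeParam, Matrix.mulVec_mulVec, h, Matrix.one_mulVec] using this
    refine ⟨fun j hj => ?_, fun i => ?_⟩
    · rw [← extendZero_add_truncate_of_lt y z hj]
      exact hy j
    · rw [← extendZero_add_truncate_of_le y z i.2]
      exact hy i
  · rintro ⟨hy, hz⟩ j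
    refine dvd_mulVec (fun j => ?_) j
    rcases lt_or_ge (j : ℕ) m with hj | hj
    · rw [extendZero_add_truncate_of_lt y z hj]
      exact hy j hj
    · rw [extendZero_add_truncate_of_le y z hj]
      exact hz _

theorem isKFreePoint_latticeParam_iff {W W' : Matrix (Fin n) (Fin n) ℤ} (h : W' * W = 1)
    (k m : ℕ) (y : Fin n → ℤ) (z : {j : Fin n // m ≤ (j : ℕ)} → ℤ) :
    IsKFreePoint k (latticeParam W m y z) ↔
      ∀ q ∈ {q : ℕ | q.Prime ∧ (q : ℤ) ^ k ∣ gcdFirst m y}, ¬ ∀ i, (q : ℤ) ^ k ∣ z i := by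
  simp only [IsKFreePoint, IsKFree, dvd_latticeParam_iff h, not_exists, Set.mem_ofPred_eq]
  exact forall_congr' fun q => by tauto

variable {Δ : Set (Fin n → ℝ)} {W W' : Matrix (Fin n) (Fin n) ℤ} {m : ℕ} {y : Fin n → ℤ}

theorem latticePoints_eq_image
    (hΔ : {x : Fin n → ℤ | (fun j => (x j : ℝ)) ∈ Δ} = Set.range (latticeParam W m y))
    {r : ℝ} (hr : 0 ≤ r) :
    latticePoints Δ r = latticeParam W m y ''
      affineBallPoints (linearParam W m) (fun j => ((W *ᵥ truncate m y) j : ℝ)) r := by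
  -- The norm on `Fin n → ℝ` is the sup norm, whose closed balls are the boxes.
  have hbox : ∀ x : Fin n → ℤ, (∀ j, (x j : ℝ) ∈ Set.Icc (-r) r) ↔
      ‖(fun j => (x j : ℝ))‖ ≤ r := fun x => by
    simp [pi_norm_le_iff_of_nonneg hr, abs_le]
  have hmem : ∀ x : Fin n → ℤ, (fun j => (x j : ℝ)) ∈ Δ ↔ x ∈ Set.range (latticeParam W m y) :=
    fun x => by rw [← hΔ]; rfl
  ext x
  simp only [latticePoints, Set.mem_ofPred_eq, hbox, hmem]
  constructor
  · rintro ⟨⟨z, rfl⟩, hz⟩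
    rw [cast_latticeParam] at hz
    exact ⟨z, hz, rfl⟩
  · rintro ⟨z, hz, rfl⟩
    rw [cast_latticeParam]
    exact ⟨⟨z, rfl⟩, hz⟩

theorem kFreePoints_eq_image (h : W' * W = 1) (k : ℕ)
    (hΔ : {x : Fin n → ℤ | (fun j => (x j : ℝ)) ∈ Δ} = Set.range (latticeParam W m y))
    {r : ℝ} (hr : 0 ≤ r) :
    kFreePoints k Δ r = latticeParam W m y ''
      siftedPoints (linearParam W m) (fun j => ((W *ᵥ truncate m y) j : ℝ)) k
        {q : ℕ | q.Prime ∧ (q : ℤ) ^ k ∣ gcdFirst m y} r := by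
  ext x
  simp only [kFreePoints, latticePoints_eq_image hΔ hr, siftedPoints]
  constructor
  · rintro ⟨⟨z, hz, rfl⟩, hx⟩
    exact ⟨z, ⟨hz, (isKFreePoint_latticeParam_iff h k m y z).mp hx⟩, rfl⟩
  · rintro ⟨z, ⟨hz, hx⟩, rfl⟩
    exact ⟨⟨z, hz, rfl⟩, (isKFreePoint_latticeParam_iff h k m y z).mpr hx⟩

theorem finite_primes_pow_dvd {k : ℕ} (hk : k ≠ 0) {g : ℤ} (hg : g ≠ 0) :
    {q : ℕ | q.Prime ∧ (q : ℤ) ^ k ∣ g}.Finite := by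
  refine (Finset.finite_toSet g.natAbs.divisors).subset fun q hq => ?_
  rw [Finset.mem_coe, Nat.mem_divisors]
  exact ⟨Int.natCast_dvd.mp ((dvd_pow_self _ hk).trans hq.2), Int.natAbs_ne_zero.mpr hg⟩

theorem hasKFreeDensity_of_range_eq (h : W' * W = 1) (k : ℕ)
    (hΔ : {x : Fin n → ℤ | (fun j => (x j : ℝ)) ∈ Δ} = Set.range (latticeParam W m y)) :
    HasKFreeDensity k Δ (∏' q : {q : ℕ | q.Prime ∧ (q : ℤ) ^ k ∣ gcdFirst m y},
      (1 - 1 / ((q : ℕ) : ℝ) ^ (k * Fintype.card {j : Fin n // m ≤ (j : ℕ)}))) := by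
  -- For `k ≠ 0`, a nonzero gcd has finitely many prime divisors, while a zero gcd kills the
  -- truncated vector and with it the translation.
  have hcases : {q : ℕ | q.Prime ∧ (q : ℤ) ^ k ∣ gcdFirst m y}.Finite ∨ k = 0 ∨
      (fun j => ((W *ᵥ truncate m y) j : ℝ)) = 0 := by
    by_cases hk : k = 0
    · exact Or.inr (Or.inl hk)
    by_cases hg : gcdFirst m y = 0
    · refine Or.inr (Or.inr ?_)
      have h0 : truncate m y = 0 := by
        rw [gcdFirst, Finset.gcd_eq_zero_iff] at hg
        funext j
        by_cases hj : m ≤ (j : ℕ)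
        · simp [truncate, hj]
        · simpa [truncate, hj] using hg j (by simpa using hj)
      rw [h0, Matrix.mulVec_zero]
      funext j
      simp
    · exact Or.inl (finite_primes_pow_dvd hk hg)
  refine (tendsto_siftedPoints (linearParam_injective h m) _ k _ (fun q hq => hq.1)
    hcases).congr' ?_
  filter_upwards [eventually_ge_atTop 0] with r hr
  rw [latticePoints_eq_image hΔ hr, kFreePoints_eq_image h k hΔ hr,
    Set.ncard_image_of_injective _ (latticeParam_injective h m y),
    Set.ncard_image_of_injective _ (latticeParam_injective h m y)]

end Parametrization

/-! ### From the hyperplanes to the theorem. -/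

theorem cast_mem_iInter_hyperplane {s n : ℕ} (A : Matrix (Fin s) (Fin n) ℤ) (p x : Fin n → ℤ) :
    (fun j => (x j : ℝ)) ∈ ⋂ i : Fin s, hyperplane (A i) p ↔ A *ᵥ x = A *ᵥ p := by
  simp only [Set.mem_iInter, hyperplane, funext_iff, Set.mem_ofPred_eq, Matrix.mulVec, dotProduct]
  exact forall_congr' fun i => by norm_cast

end KFreeDensity

theorem theorem4p2 (k s n : ℕ) (A D : Matrix (Fin s) (Fin n) ℤ)
    (U : Matrix.GeneralLinearGroup (Fin s) ℤ) (V : Matrix.GeneralLinearGroup (Fin n) ℤ)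
    (hD : KFreeDensity.IsSmithNormalForm D)
    (hUAV : (U : Matrix (Fin s) (Fin s) ℤ) * A * (V : Matrix (Fin n) (Fin n) ℤ) = D)
    (p p' : Fin n → ℤ)
    (hp' : p' = ((V⁻¹ : Matrix.GeneralLinearGroup (Fin n) ℤ) : Matrix (Fin n) (Fin n) ℤ) *ᵥ p)
    (m : ℕ) (hm : m = A.rank) :
    Multipliable (fun q : {q : ℕ // q.Prime ∧ (q : ℤ) ^ k ∣ KFreeDensity.gcdFirst m p'} =>
        (1 : ℝ) - 1 / ((q : ℕ) : ℝ) ^ (k * (n - m))) ∧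
      KFreeDensity.HasKFreeDensity k (⋂ i : Fin s, KFreeDensity.hyperplane (A i) p)
        (∏' q : {q : ℕ // q.Prime ∧ (q : ℤ) ^ k ∣ KFreeDensity.gcdFirst m p'},
          ((1 : ℝ) - 1 / ((q : ℕ) : ℝ) ^ (k * (n - m)))) := by
  have hVV : (V⁻¹ : Matrix.GeneralLinearGroup (Fin n) ℤ).val * V.val = 1 := V.inv_mul
  have hVV' : V.val * (V⁻¹ : Matrix.GeneralLinearGroup (Fin n) ℤ).val = 1 := V.mul_inv
  have hUU : (U⁻¹ : Matrix.GeneralLinearGroup (Fin s) ℤ).val * U.val = 1 := U.inv_mul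
  have hrank : m = D.rank := by
    rw [hm, ← hUAV, Matrix.rank_mul_eq_left_of_isUnit_det _ _
      ((Matrix.isUnit_iff_isUnit_det _).mp V.isUnit), Matrix.rank_mul_eq_right_of_isUnit_det _ _
      ((Matrix.isUnit_iff_isUnit_det _).mp U.isUnit)]
  have hUA : U.val * A = D * (V⁻¹ : Matrix.GeneralLinearGroup (Fin n) ℤ).val := by
    rw [← hUAV, Matrix.mul_assoc, hVV', Matrix.mul_one]
  have hΔ : {x : Fin n → ℤ | (fun j => (x j : ℝ)) ∈
      ⋂ i : Fin s, KFreeDensity.hyperplane (A i) p} =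
      Set.range (KFreeDensity.latticeParam V.val m p') := by
    rw [KFreeDensity.range_latticeParam hVV]
    ext x
    simp only [Set.mem_ofPred_eq, KFreeDensity.cast_mem_iInter_hyperplane]
    -- Multiplying by the invertible `U` turns the system into `D (V⁻¹ x) = D p'`, which only
    -- constrains the pivot coordinates.
    rw [← (KFreeDensity.mulVec_injective_of_mul_eq_one hUU).eq_iff]
    simp only [Matrix.mulVec_mulVec, hUA]
    rw [← Matrix.mulVec_mulVec, ← Matrix.mulVec_mulVec, ← hp', hD.mulVec_eq_iff]
    simp only [hD.mem_pivots_iff, hrank]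
  refine ⟨KFreeDensity.multipliable_of_mem_Icc (fun q => ?_) fun q => ?_, ?_⟩
  · have : (1 : ℝ) ≤ (q : ℕ) := mod_cast q.2.1.one_le
    exact sub_nonneg.mpr (div_le_one_of_le₀ (one_le_pow₀ this) (by positivity))
  · exact sub_le_self _ (by positivity)
  · have := KFreeDensity.hasKFreeDensity_of_range_eq hVV k hΔ
    rwa [hD.card_le_coe hrank] at this
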